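/- Let $d\ge 1$ be an integer and let $u\in L^1(\mathbb R^d)\cap L^\infty(\mathbb R^d)$ be nonnegative. Let $u^*$ be its Schwarz symmetrization, $u^*(x)=\inf\{t\ge 0:\ \mathrm{meas}\{u>t\}\le \mathrm{meas}\,B(0,|x|)\}$, where $\mathrm{meas}$ is Lebesgue measure and $B(0,r)$ is the ball of $\mathbb R^d$ with centre $0$ and radius $r$. Let $K_d$ be the volume of the unit ball of $\mathbb R^d$. Then for every real $m$ with $0\le m\le d$, $$\int_{\mathbb R^d}|x|^m\bigl(u(x)-u^*(x)\bigr)\,dx\ \ge\ \frac{m}{4d}\,K_d^{-m/d}\,\|u\|_{L^1}^{-1+m/d}\,\|u\|_{L^\infty}^{-m/d}\,\|u-u^*\|_{L^1}^2 .$$ Here the right-hand side is read as $0$ if $u=0$. If $|x|^m(u-u^*)$ is not integrable, the inequality is understood in $[0,\infty]$ as $$\int_{\mathbb R^d}|x|^m(u-u^*)_+\,dx\ \ge\ \int_{\mathbb R^d}|x|^m(u-u^*)_-\,dx+\frac{m}{4d}\,K_d^{-m/d}\,\|u\|_{L^1}^{-1+m/d}\,\|u\|_{L^\infty}^{-m/d}\,\|u-u^*\|_{L^1}^2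 .$$ -/

import Mathlib

open MeasureTheory
open scoped NNReal ENNReal

namespace Rearrangement

noncomputable section

/-- The distribution function `μ_q(t) = meas {x ∈ ℝ^d : q x > t}`, `t ≥ 0`. -/
def distribution {d : ℕ} (q : EuclideanSpace ℝ (Fin d) → ℝ) (t : ℝ≥0) : ℝ≥0∞ :=
  volume {x | (t : ℝ) < q x}

/-- The pseudo-inverse `q♯(s) = inf {t ≥ 0 : μ_q(t) ≤ s}` of the distribution function,
with values in `[0, ∞]` (the infimum of the empty set is `∞`). -/
def sharp {d : ℕ} (q : EuclideanSpace ℝ (Fin d) → ℝ) (s : ℝ≥0∞) : ℝ≥0∞ :=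
  ⨅ (t : ℝ≥0) (_ : distribution q t ≤ s), (t : ℝ≥0∞)

/-- The Schwarz symmetrization `q*(x) = q♯(meas B(0, |x|))` on `ℝ^d`, as a real function.
For an essentially bounded `q` the value `q♯(s)` is finite for every `s`, so that `toReal`
loses nothing. -/
def schwarz {d : ℕ} (q : EuclideanSpace ℝ (Fin d) → ℝ) (x : EuclideanSpace ℝ (Fin d)) : ℝ :=
  (sharp q (volume (Metric.ball (0 : EuclideanSpace ℝ (Fin d)) ‖x‖))).toReal

/-- The volume `K_d` of the unit ball of `ℝ^d`. -/
def unitBallVolume (d : ℕ) : ℝ :=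
  (volume (Metric.ball (0 : EuclideanSpace ℝ (Fin d)) 1)).toReal

/-- The factor `(m / 4d) K_d^{-m/d} ‖u‖_{L¹}^{-1+m/d} ‖u‖_{L^∞}^{-m/d}`. -/
def stabilityConst {d : ℕ} (m : ℝ) (u : EuclideanSpace ℝ (Fin d) → ℝ) : ℝ :=
  m / (4 * (d : ℝ)) * unitBallVolume d ^ (-(m / (d : ℝ)))
    * (eLpNorm u 1 volume).toReal ^ (-1 + m / (d : ℝ))
    * (eLpNorm u ∞ volume).toReal ^ (-(m / (d : ℝ)))

end

end Rearrangement

/-! Put `p = m / d`, which lies in `[0, 1]`, and use the volume coordinate V(x) = K_d|x|^d. Then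
|x|^m = K_d^{-p} V^p, and V pushes Lebesgue measure of ℝ^d to Lebesgue measure of [0, ∞). By the
layer cake formula it suffices to compare, for each t > 0, the set E = {u > t} with B = {u* > t} =
{V < a}, where a = |E|. Both differences E \ B and B \ E have the same measure δ. By the bathtub
principle the integral of V^p over B \ E is at most that of s^p over [a - δ, a), and over E \ B it
is at least that of s^p over [a, a + δ). Concavity of s^p makes the gap at least p a^{p-1} δ²
(`setLIntegral_rpow_sublevel_diff_add_le`). Integrating in t bounds the weighted difference below by
p times `layerDeficit`, the integral of a^{p-1} δ². On the other side ‖u - u*‖₁ is the integral of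
2δ, so Cauchy–Schwarz against a^{1-p}, followed by Hölder on (0, ‖u‖_∞), bounds its square by 4
‖u‖₁^{1-p} ‖u‖_∞^p times the deficit (`lintegral_enorm_sub_schwarz_sq_le`). -/

namespace Rearrangement

/-! ### Concave powers on the line -/

/-- The symmetric difference quotient of a concave power dominates its derivative at the centre,
normalised to the centre `1`. -/
theorem two_mul_le_one_add_rpow_sub_one_sub_rpow {p : ℝ} (hp0 : 0 ≤ p) (hp1 : p ≤ 1) {x : ℝ}
    (hx0 : 0 ≤ x) (hx1 : x ≤ 1) : 2 * p * x ≤ (1 + x) ^ p - (1 - x) ^ p := by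
  have hder : ∀ y ∈ Set.Ioo (0 : ℝ) 1, HasDerivAt
      (fun y : ℝ => (1 + y) ^ p - (1 - y) ^ p - 2 * p * y)
      (p * ((1 + y) ^ (p - 1) + (1 - y) ^ (p - 1) - 2)) y := by
    intro y hy
    have h1 : HasDerivAt (fun y : ℝ => (1 + y) ^ p) (1 * p * (1 + y) ^ (p - 1)) y :=
      ((hasDerivAt_id y).const_add 1).rpow_const (Or.inl (by simp; linarith [hy.1]))
    have h2 : HasDerivAt (fun y : ℝ => (1 - y) ^ p) (-1 * p * (1 - y) ^ (p - 1)) y :=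
      ((hasDerivAt_id y).const_sub 1).rpow_const (Or.inl (by simp; linarith [hy.2]))
    have h3 : HasDerivAt (fun y : ℝ => 2 * p * y) (2 * p * 1) y :=
      (hasDerivAt_id y).const_mul (2 * p)
    exact ((h1.sub h2).sub h3).congr_deriv (by ring)
  have hmono : MonotoneOn (fun y : ℝ => (1 + y) ^ p - (1 - y) ^ p - 2 * p * y)
      (Set.Icc 0 1) := by
    refine monotoneOn_of_deriv_nonneg (convex_Icc 0 1) ?_ ?_ ?_
    · refine Continuous.continuousOn ?_
      exact (((continuous_const.add continuous_id).rpow_const fun _ => Or.inr hp0).sub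
        ((continuous_const.sub continuous_id).rpow_const fun _ => Or.inr hp0)).sub
        (continuous_const.mul continuous_id)
    · intro y hy
      rw [interior_Icc] at hy
      exact (hder y hy).differentiableAt.differentiableWithinAt
    · intro y hy
      rw [interior_Icc] at hy
      rw [(hder y hy).deriv]
      refine mul_nonneg hp0 ?_
      have hpos1 : 0 < 1 + y := by linarith [hy.1]
      have hpos2 : 0 < 1 - y := by linarith [hy.2]
      -- By AM–GM the sum of the two powers is at least 2 once their product is at least 1; the
      -- product is (1 - y²)^{p-1}, with nonpositive exponent.
      have hprod : 1 ≤ (1 + y) ^ (p - 1) * (1 - y) ^ (p - 1) := by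
        rw [← Real.mul_rpow hpos1.le hpos2.le]
        refine Real.one_le_rpow_of_pos_of_le_one_of_nonpos (mul_pos hpos1 hpos2) ?_ (by linarith)
        nlinarith [sq_nonneg y]
      have hq1 := Real.rpow_pos_of_pos hpos1 (p - 1)
      have hq2 := Real.rpow_pos_of_pos hpos2 (p - 1)
      nlinarith [sq_nonneg ((1 + y) ^ (p - 1) - (1 - y) ^ (p - 1))]
  have h := hmono (Set.left_mem_Icc.2 zero_le_one) ⟨hx0, hx1⟩ hx0
  simp only [add_zero, sub_zero, Real.one_rpow, mul_zero, sub_self] at h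
  linarith

theorem two_mul_le_add_rpow_sub_sub_rpow {p a s : ℝ} (hp0 : 0 ≤ p) (hp1 : p ≤ 1) (ha : 0 < a)
    (hs0 : 0 ≤ s) (hsa : s ≤ a) :
    2 * p * a ^ (p - 1) * s ≤ (a + s) ^ p - (a - s) ^ p := by
  have h := two_mul_le_one_add_rpow_sub_one_sub_rpow hp0 hp1 (div_nonneg hs0 ha.le)
    ((div_le_one ha).2 hsa)
  have h1 : (a + s) ^ p = a ^ p * (1 + s / a) ^ p := by
    rw [← Real.mul_rpow ha.le (by positivity)]
    congr 1
    field_simp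
  have h2 : (a - s) ^ p = a ^ p * (1 - s / a) ^ p := by
    rw [← Real.mul_rpow ha.le (by rw [sub_nonneg, div_le_one ha]; exact hsa)]
    congr 1
    field_simp
  rw [h1, h2, ← mul_sub, Real.rpow_sub_one ha.ne']
  calc 2 * p * (a ^ p / a) * s = a ^ p * (2 * p * (s / a)) := by ring
    _ ≤ _ := mul_le_mul_of_nonneg_left h (Real.rpow_nonneg ha.le p)

/-- Comparison of the integrals of a concave power over the two halves of an interval. -/
theorem integral_rpow_add_le_integral_rpow {p a δ : ℝ} (hp0 : 0 ≤ p) (hp1 : p ≤ 1) (ha : 0 < a)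
    (hδ0 : 0 ≤ δ) (hδa : δ ≤ a) :
    (∫ s in (a - δ)..a, s ^ p) + p * a ^ (p - 1) * δ ^ 2 ≤ ∫ s in a..(a + δ), s ^ p := by
  have hc1 : Continuous fun s : ℝ => (a + s) ^ p :=
    (continuous_const.add continuous_id).rpow_const fun _ => Or.inr hp0
  have hc2 : Continuous fun s : ℝ => (a - s) ^ p :=
    (continuous_const.sub continuous_id).rpow_const fun _ => Or.inr hp0
  have h1 : ∫ s in (0 : ℝ)..δ, (a + s) ^ p = ∫ s in a..(a + δ), s ^ p := by
    rw [intervalIntegral.integral_comp_add_left (fun s : ℝ => s ^ p), add_zero]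
  have h2 : ∫ s in (0 : ℝ)..δ, (a - s) ^ p = ∫ s in (a - δ)..a, s ^ p := by
    rw [intervalIntegral.integral_comp_sub_left (fun s : ℝ => s ^ p), sub_zero]
  have h3 : ∫ s in (0 : ℝ)..δ, 2 * p * a ^ (p - 1) * s = p * a ^ (p - 1) * δ ^ 2 := by
    rw [intervalIntegral.integral_const_mul, integral_id]
    ring
  rw [← h1, ← h2, ← h3, ← le_sub_iff_add_le', ← intervalIntegral.integral_sub
    (hc1.intervalIntegrable _ _) (hc2.intervalIntegrable _ _)]
  refine intervalIntegral.integral_mono_on hδ0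
    ((continuous_const.mul continuous_id).intervalIntegrable _ _)
    ((hc1.sub hc2).intervalIntegrable _ _) fun s hs => ?_
  exact two_mul_le_add_rpow_sub_sub_rpow hp0 hp1 ha hs.1 (hs.2.trans hδa)

theorem setLIntegral_Ico_rpow {p a b : ℝ} (hp0 : 0 ≤ p) (ha : 0 ≤ a) (hab : a ≤ b) :
    ∫⁻ s in Set.Ico a b, ENNReal.ofReal (s ^ p) = ENNReal.ofReal (∫ s in a..b, s ^ p) := by
  have hc : Continuous fun s : ℝ => s ^ p := continuous_id.rpow_const fun _ => Or.inr hp0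
  rw [intervalIntegral.integral_of_le hab, ← integral_Ico_eq_integral_Ioc,
    ofReal_integral_eq_lintegral_ofReal]
  · exact (hc.integrableOn_Icc (a := a) (b := b)).mono_set Set.Ico_subset_Icc_self
  · filter_upwards [ae_restrict_mem measurableSet_Ico] with s hs
    exact Real.rpow_nonneg (ha.trans hs.1) p

/-! ### Bathtub principle, uniform distribution and layer cake on a measure space -/

section Abstract

variable {α : Type*} [MeasurableSpace α] {μ : Measure α}

theorem measure_sdiff_comm_of_measure_eq {A F : Set α} (hA : MeasurableSet A)
    (hF : MeasurableSet F) (hAF : μ A = μ F) (hfin : μ F ≠ ∞) : μ (A \ F) = μ (F \ A) := by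
  have h1 := measure_sdiff_add_inter (μ := μ) A hF
  have h2 := measure_sdiff_add_inter (μ := μ) F hA
  rw [Set.inter_comm F A, ← hAF, ← h1] at h2
  exact ((ENNReal.add_left_inj (measure_ne_top_of_subset Set.inter_subset_right hfin)).1 h2).symm

/-- The bathtub principle. -/
theorem setLIntegral_le_of_threshold {A F : Set α} (hA : MeasurableSet A) (hF : MeasurableSet F)
    (hAF : μ A = μ F) (hfin : μ F ≠ ∞) {h : α → ℝ≥0∞} {c : ℝ≥0∞}
    (hle : ∀ x ∈ A \ F, h x ≤ c) (hge : ∀ x ∈ F \ A, c ≤ h x) :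
    ∫⁻ x in A, h x ∂μ ≤ ∫⁻ x in F, h x ∂μ := by
  have hdiff := measure_sdiff_comm_of_measure_eq hA hF hAF hfin
  rw [← lintegral_inter_add_sdiff h A hF, ← lintegral_inter_add_sdiff h F hA, Set.inter_comm F A]
  refine add_le_add le_rfl ?_
  calc ∫⁻ x in A \ F, h x ∂μ ≤ ∫⁻ _ in A \ F, c ∂μ := setLIntegral_mono' (hA.diff hF) hle
    _ = ∫⁻ _ in F \ A, c ∂μ := by simp [hdiff]
    _ ≤ ∫⁻ x in F \ A, h x ∂μ := setLIntegral_mono' (hF.diff hA) hge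

/-- A function with uniform distribution on `[0, ∞)` pushes the measure to Lebesgue measure. -/
theorem map_eq_volume_restrict_Ici {V : α → ℝ} (hVm : Measurable V)
    (hV : ∀ s, μ {x | V x < s} = ENNReal.ofReal s) :
    μ.map V = (volume : Measure ℝ).restrict (Set.Ici 0) := by
  refine (Measure.ext_of_Ico _ _ fun a b hab => ?_).symm
  rw [Measure.restrict_apply measurableSet_Ico, Measure.map_apply hVm measurableSet_Ico]
  have h1 : V ⁻¹' Set.Ico a b = {x | V x < b} \ {x | V x < a} := by
    ext x
    simp [and_comm]
  have h2 : Set.Ico a b ∩ Set.Ici 0 = Set.Ico (max a 0) b := by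
    ext x
    simp only [Set.mem_inter_iff, Set.mem_Ico, Set.mem_Ici, max_le_iff]
    tauto
  have h3 : {x | V x < a} ⊆ {x | V x < b} := fun x (hx : V x < a) => hx.trans hab
  rw [h1, h2, measure_sdiff h3 (measurableSet_lt hVm measurable_const).nullMeasurableSet
    (by rw [hV]; exact ENNReal.ofReal_ne_top), hV, hV, Real.volume_Ico]
  rcases le_total a 0 with h | h
  · simp [h, ENNReal.ofReal_of_nonpos h]
  · rw [max_eq_left h, ENNReal.ofReal_sub _ h]

theorem setLIntegral_comp_of_uniform {V : α → ℝ} (hVm : Measurable V)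
    (hV : ∀ s, μ {x | V x < s} = ENNReal.ofReal s) {a b : ℝ} (ha : 0 ≤ a) {f : ℝ → ℝ≥0∞}
    (hf : Measurable f) :
    ∫⁻ x in V ⁻¹' Set.Ico a b, f (V x) ∂μ = ∫⁻ s in Set.Ico a b, f s := by
  rw [← setLIntegral_map measurableSet_Ico hf hVm, map_eq_volume_restrict_Ici hVm hV,
    Measure.restrict_restrict measurableSet_Ico, Set.inter_eq_left.2]
  exact fun s hs => ha.trans hs.1

theorem measure_preimage_Ico_of_uniform {V : α → ℝ} (hVm : Measurable V)
    (hV : ∀ s, μ {x | V x < s} = ENNReal.ofReal s) {a b : ℝ} (ha : 0 ≤ a) :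
    μ (V ⁻¹' Set.Ico a b) = ENNReal.ofReal (b - a) := by
  have h := setLIntegral_comp_of_uniform hVm hV ha (b := b) (f := fun _ => 1) measurable_const
  simpa using h

/-- Quantitative comparison of a set with the sublevel set of `V` of the same measure. -/
theorem setLIntegral_rpow_sublevel_diff_add_le {V : α → ℝ} (hVm : Measurable V) (hV0 : ∀ x, 0 ≤ V x)
    (hV : ∀ s, μ {x | V x < s} = ENNReal.ofReal s) {p : ℝ} (hp0 : 0 ≤ p) (hp1 : p ≤ 1)
    {E B : Set α} (hE : MeasurableSet E) (hEfin : μ E ≠ ∞)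
    (hB : B = {x | ENNReal.ofReal (V x) < μ E}) :
    (∫⁻ x in B \ E, ENNReal.ofReal (V x ^ p) ∂μ)
        + ENNReal.ofReal p * (μ E ^ (p - 1) * μ (E \ B) ^ 2)
      ≤ ∫⁻ x in E \ B, ENNReal.ofReal (V x ^ p) ∂μ := by
  -- For a null set the power `μ E ^ (p - 1)` may be infinite, but it multiplies zero.
  rcases eq_or_ne (μ E) 0 with hE0 | hE0
  · have h1 : B = ∅ := by simp [hB, hE0]
    have h2 : μ (E \ B) = 0 := by rw [h1, Set.sdiff_empty, hE0]
    rw [h2, h1]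
    simp
  obtain ⟨a, ha, haE⟩ : ∃ a : ℝ, 0 < a ∧ μ E = ENNReal.ofReal a :=
    ⟨(μ E).toReal, ENNReal.toReal_pos hE0 hEfin, (ENNReal.ofReal_toReal hEfin).symm⟩
  have hB' : B = {x | V x < a} := by
    simp only [hB, haE, ENNReal.ofReal_lt_ofReal_iff ha]
  have hBm : MeasurableSet B := hB' ▸ measurableSet_lt hVm measurable_const
  have hBE : μ B = μ E := by rw [hB', hV, haE]
  have hdiff := measure_sdiff_comm_of_measure_eq hBm hE hBE hEfin
  have hdfin : μ (E \ B) ≠ ∞ := measure_ne_top_of_subset Set.sdiff_subset hEfin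
  obtain ⟨δ, hδ0, hδ⟩ : ∃ δ : ℝ, 0 ≤ δ ∧ μ (E \ B) = ENNReal.ofReal δ :=
    ⟨_, ENNReal.toReal_nonneg, (ENNReal.ofReal_toReal hdfin).symm⟩
  have hδa : δ ≤ a := by
    rw [← ENNReal.ofReal_le_ofReal_iff ha.le, ← hδ, ← haE]
    exact measure_mono Set.sdiff_subset
  have hmeas : Measurable fun s : ℝ => ENNReal.ofReal (s ^ p) :=
    ENNReal.measurable_ofReal.comp (measurable_id.pow_const p)
  -- Among subsets of `B` of measure `δ`, the outermost shell carries the largest weight.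
  have hinner : ∫⁻ x in B \ E, ENNReal.ofReal (V x ^ p) ∂μ
      ≤ ∫⁻ x in V ⁻¹' Set.Ico (a - δ) a, ENNReal.ofReal (V x ^ p) ∂μ := by
    have hm := measure_preimage_Ico_of_uniform hVm hV (sub_nonneg.2 hδa) (b := a)
    rw [sub_sub_cancel] at hm
    refine setLIntegral_le_of_threshold (c := ENNReal.ofReal ((a - δ) ^ p)) (hBm.diff hE)
      (hVm measurableSet_Ico) (by rw [hm, hdiff, hδ]) (by simp [hm]) ?_ ?_
    · rintro x ⟨hx1, hx2⟩
      rw [hB'] at hx1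
      have hx : V x < a - δ := by
        by_contra! h
        exact hx2 ⟨h, hx1.1⟩
      exact ENNReal.ofReal_le_ofReal (Real.rpow_le_rpow (hV0 x) hx.le hp0)
    · rintro x ⟨hx1, -⟩
      exact ENNReal.ofReal_le_ofReal (Real.rpow_le_rpow (sub_nonneg.2 hδa) hx1.1 hp0)
  -- Among sets of measure `δ` outside `B`, the shell adjacent to `B` carries the smallest weight.
  have houter : ∫⁻ x in V ⁻¹' Set.Ico a (a + δ), ENNReal.ofReal (V x ^ p) ∂μ
      ≤ ∫⁻ x in E \ B, ENNReal.ofReal (V x ^ p) ∂μ := by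
    have hm := measure_preimage_Ico_of_uniform hVm hV ha.le (b := a + δ)
    rw [add_sub_cancel_left] at hm
    refine setLIntegral_le_of_threshold (c := ENNReal.ofReal ((a + δ) ^ p))
      (hVm measurableSet_Ico) (hE.diff hBm) (by rw [hm, hδ]) hdfin ?_ ?_
    · rintro x ⟨hx1, -⟩
      exact ENNReal.ofReal_le_ofReal (Real.rpow_le_rpow (hV0 x) hx1.2.le hp0)
    · rintro x ⟨hx1, hx2⟩
      rw [hB'] at hx1
      have hxa : a ≤ V x := not_lt.1 hx1.2
      have hx : a + δ ≤ V x := by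
        by_contra! h
        exact hx2 ⟨hxa, h⟩
      exact ENNReal.ofReal_le_ofReal (Real.rpow_le_rpow (by linarith) hx hp0)
  rw [setLIntegral_comp_of_uniform hVm hV (sub_nonneg.2 hδa) hmeas,
    setLIntegral_Ico_rpow hp0 (sub_nonneg.2 hδa) (by linarith)] at hinner
  rw [setLIntegral_comp_of_uniform hVm hV ha.le hmeas,
    setLIntegral_Ico_rpow hp0 ha.le (by linarith)] at houter
  refine (add_le_add_left hinner _).trans (le_trans ?_ houter)
  rw [haE, hδ, ENNReal.ofReal_rpow_of_pos ha, ← ENNReal.ofReal_pow hδ0,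
    ← ENNReal.ofReal_mul (by positivity), ← ENNReal.ofReal_mul hp0, ← ENNReal.ofReal_add]
  · refine ENNReal.ofReal_le_ofReal (le_trans (le_of_eq ?_)
      (integral_rpow_add_le_integral_rpow hp0 hp1 ha hδ0 hδa))
    ring
  · exact intervalIntegral.integral_nonneg (by linarith) fun s hs =>
      Real.rpow_nonneg (by linarith [hs.1]) p
  · positivity

/-- Layer cake representation of the positive part of a difference. -/
theorem lintegral_mul_ofReal_sub_eq_lintegral_layer [SFinite μ] {f g : α → ℝ} (hf : Measurable f)
    (hg : Measurable g) (hg0 : ∀ x, 0 ≤ g x) {w : α → ℝ≥0∞} (hw : Measurable w) :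
    ∫⁻ x, w x * ENNReal.ofReal (f x - g x) ∂μ
      = ∫⁻ t in Set.Ioi (0 : ℝ), ∫⁻ x in {x | t < f x} \ {x | t < g x}, w x ∂μ := by
  have hset : MeasurableSet {z : α × ℝ | z.2 < f z.1 ∧ g z.1 ≤ z.2} :=
    (measurableSet_lt measurable_snd (hf.comp measurable_fst)).inter
      (measurableSet_le (hg.comp measurable_fst) measurable_snd)
  have hslice : ∀ t, MeasurableSet ({x | t < f x} \ {x | t < g x}) := fun t =>
    (measurableSet_lt measurable_const hf).diff (measurableSet_lt measurable_const hg)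
  have hx : ∀ x, w x * ENNReal.ofReal (f x - g x) = ∫⁻ t in Set.Ioi (0 : ℝ),
      {z : α × ℝ | z.2 < f z.1 ∧ g z.1 ≤ z.2}.indicator (fun z => w z.1) (x, t) := by
    intro x
    have h1 : ∀ t, {z : α × ℝ | z.2 < f z.1 ∧ g z.1 ≤ z.2}.indicator (fun z => w z.1) (x, t)
        = (Set.Ico (g x) (f x)).indicator (fun _ => w x) t := by
      intro t
      simp only [Set.indicator, Set.mem_ofPred_eq, Set.mem_Ico, and_comm]
    -- Levels start at 0, so nonnegativity of `g` ensures that no part of the interval is lost; the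
    -- endpoint 0 is negligible.
    have h2 : Set.Ico (g x) (f x) ⊆ Set.Ici 0 := fun t ht => (hg0 x).trans ht.1
    simp_rw [h1]
    rw [setLIntegral_congr Ioi_ae_eq_Ici, lintegral_indicator measurableSet_Ico,
      Measure.restrict_restrict measurableSet_Ico, Set.inter_eq_left.2 h2,
      setLIntegral_const, Real.volume_Ico]
  simp_rw [hx]
  rw [lintegral_lintegral_swap]
  · refine lintegral_congr fun t => ?_
    rw [← lintegral_indicator (hslice t)]
    refine lintegral_congr fun x => ?_
    simp only [Set.indicator, Set.mem_ofPred_eq, Set.mem_sdiff, not_lt]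
  · exact ((hw.comp measurable_fst).indicator hset).aemeasurable

end Abstract

/-! ### The volume coordinate on ℝ^d -/

theorem unitBallVolume_pos (d : ℕ) : 0 < unitBallVolume d :=
  ENNReal.toReal_pos (Metric.measure_ball_pos volume _ one_pos).ne' measure_ball_lt_top.ne

/-- The volume of the ball centred at `0` through `x`. -/
noncomputable def ballVolume {d : ℕ} (x : EuclideanSpace ℝ (Fin d)) : ℝ :=
  unitBallVolume d * ‖x‖ ^ d

section

variable {d : ℕ}

theorem ballVolume_nonneg (x : EuclideanSpace ℝ (Fin d)) : 0 ≤ ballVolume x :=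
  mul_nonneg (unitBallVolume_pos d).le (by positivity)

theorem measurable_ballVolume : Measurable (ballVolume (d := d)) := by
  unfold ballVolume
  fun_prop

theorem volume_ball_zero (hd : 1 ≤ d) {r : ℝ} (hr : 0 ≤ r) :
    volume (Metric.ball (0 : EuclideanSpace ℝ (Fin d)) r)
      = ENNReal.ofReal (unitBallVolume d * r ^ d) := by
  have : Nonempty (Fin d) := ⟨⟨0, hd⟩⟩
  rw [Measure.addHaar_ball volume _ hr, finrank_euclideanSpace_fin, mul_comm (unitBallVolume d),
    ENNReal.ofReal_mul (by positivity), unitBallVolume, ENNReal.ofReal_toReal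
    measure_ball_lt_top.ne]

/-- The sublevel set is the centred ball of volume `s`. This is the uniformity that the abstract
lemmas require of `V`. -/
theorem volume_ballVolume_lt (hd : 1 ≤ d) (s : ℝ) :
    volume {x : EuclideanSpace ℝ (Fin d) | ballVolume x < s} = ENNReal.ofReal s := by
  rcases le_or_gt s 0 with hs | hs
  · rw [ENNReal.ofReal_of_nonpos hs]
    convert measure_empty (μ := (volume : Measure (EuclideanSpace ℝ (Fin d))))
    refine Set.eq_empty_of_forall_notMem fun x (hx : ballVolume x < s) => ?_
    linarith [ballVolume_nonneg x]
  · have hK := unitBallVolume_pos d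
    set r : ℝ := (s / unitBallVolume d) ^ ((d : ℝ)⁻¹) with hr
    have hr0 : 0 ≤ r := by positivity
    have hrd : r ^ d = s / unitBallVolume d :=
      Real.rpow_inv_natCast_pow (by positivity) (by omega)
    have hset : {x : EuclideanSpace ℝ (Fin d) | ballVolume x < s} = Metric.ball 0 r := by
      ext x
      rw [mem_ball_zero_iff, ← pow_lt_pow_iff_left₀ (norm_nonneg x) hr0 (n := d) (by omega), hrd,
        lt_div_iff₀' hK]
      rfl
    rw [hset, volume_ball_zero hd hr0, hrd, mul_div_cancel₀ _ hK.ne']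

/-! ### Superlevel sets of the Schwarz symmetrization -/

theorem distribution_antitone (q : EuclideanSpace ℝ (Fin d) → ℝ) : Antitone (distribution q) :=
  fun _ t hst => measure_mono fun x (hx : (t : ℝ) < q x) =>
    lt_of_le_of_lt (NNReal.coe_le_coe.2 hst) hx

/-- The infimum is attained because the distribution function is right continuous, by continuity of
measure along the increasing sets {q > t + 1/(n+1)}. -/
theorem sharp_le_coe_iff {q : EuclideanSpace ℝ (Fin d) → ℝ} {s : ℝ≥0∞} {t : ℝ≥0} :
    sharp q s ≤ t ↔ distribution q t ≤ s := by
  refine ⟨fun h => ?_, fun h => iInf₂_le t h⟩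
  have hlim : ∀ n : ℕ, distribution q (t + 1 / ((n : ℝ≥0) + 1)) ≤ s := by
    intro n
    have hlt : sharp q s < ((t + 1 / ((n : ℝ≥0) + 1) : ℝ≥0) : ℝ≥0∞) := by
      refine h.trans_lt (ENNReal.coe_lt_coe.2 (lt_add_of_pos_right t ?_))
      positivity
    simp only [sharp, iInf_lt_iff] at hlt
    obtain ⟨t', ht', hlt'⟩ := hlt
    exact (distribution_antitone q (ENNReal.coe_lt_coe.1 hlt').le).trans ht'
  have hunion : {x | (t : ℝ) < q x}
      = ⋃ n : ℕ, {x | ((t + 1 / ((n : ℝ≥0) + 1) : ℝ≥0) : ℝ) < q x} := by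
    ext x
    simp only [Set.mem_ofPred_eq, Set.mem_iUnion]
    constructor
    · intro hx
      obtain ⟨n, hn⟩ := exists_nat_one_div_lt (sub_pos.2 hx)
      refine ⟨n, ?_⟩
      push_cast
      linarith
    · rintro ⟨n, hn⟩
      refine lt_of_le_of_lt ?_ hn
      push_cast
      have : (0 : ℝ) ≤ 1 / ((n : ℝ) + 1) := by positivity
      linarith
  have hmono : Monotone fun n : ℕ => {x | ((t + 1 / ((n : ℝ≥0) + 1) : ℝ≥0) : ℝ) < q x} := by
    intro m n hmn x (hx : _ < q x)
    refine lt_of_le_of_lt ?_ hx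
    push_cast
    have := Nat.one_div_le_one_div (α := ℝ) hmn
    linarith
  rw [distribution, hunion, hmono.measure_iUnion]
  exact iSup_le hlim

theorem schwarz_nonneg (q : EuclideanSpace ℝ (Fin d) → ℝ) (x : EuclideanSpace ℝ (Fin d)) :
    0 ≤ schwarz q x := ENNReal.toReal_nonneg

/-- Essential boundedness keeps the pseudo-inverse finite, so `toReal` preserves order and the claim
is the negation of `sharp_le_coe_iff`. -/
theorem coe_lt_schwarz_iff (hd : 1 ≤ d) {q : EuclideanSpace ℝ (Fin d) → ℝ} {M : ℝ≥0}
    (hM : distribution q M = 0) (t : ℝ≥0) (x : EuclideanSpace ℝ (Fin d)) :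
    (t : ℝ) < schwarz q x ↔ ENNReal.ofReal (ballVolume x) < distribution q t := by
  have hfin : sharp q (volume (Metric.ball (0 : EuclideanSpace ℝ (Fin d)) ‖x‖)) ≠ ∞ :=
    ne_top_of_le_ne_top ENNReal.coe_ne_top (sharp_le_coe_iff.2 (hM.le.trans zero_le))
  rw [ballVolume, ← volume_ball_zero hd (norm_nonneg x), ← not_le, ← not_le, ← sharp_le_coe_iff,
    schwarz, ← ENNReal.coe_toReal t, ENNReal.toReal_le_toReal hfin ENNReal.coe_ne_top]

theorem measurable_schwarz (hd : 1 ≤ d) {q : EuclideanSpace ℝ (Fin d) → ℝ} {M : ℝ≥0}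
    (hM : distribution q M = 0) : Measurable (schwarz q) := by
  refine measurable_of_Ioi fun a => ?_
  rcases lt_or_ge a 0 with ha | ha
  · convert MeasurableSet.univ
    exact Set.eq_univ_of_forall fun x => ha.trans_le (schwarz_nonneg q x)
  · lift a to ℝ≥0 using ha
    have : schwarz q ⁻¹' Set.Ioi (a : ℝ) = {x | ENNReal.ofReal (ballVolume x) < distribution q a} :=
      Set.ext fun x => coe_lt_schwarz_iff hd hM a x
    rw [this]
    exact measurableSet_lt measurable_ballVolume.ennreal_ofReal measurable_const

theorem schwarz_congr_ae {u v : EuclideanSpace ℝ (Fin d) → ℝ} (h : u =ᵐ[volume] v) :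
    schwarz u = schwarz v := by
  have hdist : distribution u = distribution v := by
    funext t
    refine measure_congr ?_
    filter_upwards [h] with x hx
    exact congrArg (fun y => (t : ℝ) < y) hx
  funext x
  simp only [schwarz, sharp, hdist]

/-! ### The layer deficit and its two bounds -/

/-- The deficit `∫₀^∞ |{v > t}|^{p-1} |{v > t} \ {v* > t}|² dt`. -/
noncomputable def layerDeficit (p : ℝ) (v : EuclideanSpace ℝ (Fin d) → ℝ) : ℝ≥0∞ :=
  ∫⁻ t in Set.Ioi (0 : ℝ),
    volume {x | t < v x} ^ (p - 1) * volume ({x | t < v x} \ {x | t < schwarz v x}) ^ 2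

theorem measurable_volume_superlevel (v : EuclideanSpace ℝ (Fin d) → ℝ) :
    Measurable fun t : ℝ => volume {x | t < v x} :=
  Antitone.measurable fun _ t hst => measure_mono fun x (hx : t < v x) => lt_of_le_of_lt hst hx

theorem measurable_volume_superlevel_diff {f g : EuclideanSpace ℝ (Fin d) → ℝ} (hf : Measurable f)
    (hg : Measurable g) : Measurable fun t : ℝ => volume ({x | t < f x} \ {x | t < g x}) :=
  measurable_measure_prodMk_left
    (s := {z : ℝ × EuclideanSpace ℝ (Fin d) | z.1 < f z.2} \ {z | z.1 < g z.2})
    ((measurableSet_lt measurable_fst (hf.comp measurable_snd)).diff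
      (measurableSet_lt measurable_fst (hg.comp measurable_snd)))

theorem superlevel_schwarz (hd : 1 ≤ d) {v : EuclideanSpace ℝ (Fin d) → ℝ} {M : ℝ≥0}
    (hM : distribution v M = 0) {t : ℝ} (ht : 0 ≤ t) :
    {x | t < schwarz v x} = {x | ENNReal.ofReal (ballVolume x) < volume {x | t < v x}} := by
  lift t to ℝ≥0 using ht
  exact Set.ext fun x => coe_lt_schwarz_iff hd hM t x

theorem volume_superlevel_schwarz (hd : 1 ≤ d) {v : EuclideanSpace ℝ (Fin d) → ℝ} {M : ℝ≥0}
    (hM : distribution v M = 0) {t : ℝ} (ht : 0 ≤ t) (hfin : volume {x | t < v x} ≠ ∞) :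
    volume {x | t < schwarz v x} = volume {x | t < v x} := by
  rw [superlevel_schwarz hd hM ht]
  rcases eq_or_ne (volume {x | t < v x}) 0 with h0 | h0
  · simp [h0]
  · conv_rhs => rw [← ENNReal.ofReal_toReal hfin, ← volume_ballVolume_lt hd]
    congr 1
    ext x
    exact ENNReal.ofReal_lt_iff_lt_toReal (ballVolume_nonneg x) hfin

theorem volume_superlevel_ne_top {v : EuclideanSpace ℝ (Fin d) → ℝ} (hv : Integrable v) {t : ℝ}
    (ht : 0 < t) : volume {x | t < v x} ≠ ∞ :=
  (hv.measure_gt_lt_top ht).ne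

/-- Stability of the weighted integral in terms of the superlevel sets. -/
theorem lintegral_rpow_ballVolume_add_layerDeficit_le (hd : 1 ≤ d) {p : ℝ} (hp0 : 0 ≤ p)
    (hp1 : p ≤ 1) {v : EuclideanSpace ℝ (Fin d) → ℝ} (hvm : Measurable v) (hv0 : ∀ x, 0 ≤ v x)
    (hv : Integrable v) {M : ℝ≥0} (hM : distribution v M = 0) :
    (∫⁻ x, ENNReal.ofReal (ballVolume x ^ p) * ENNReal.ofReal (schwarz v x - v x))
        + ENNReal.ofReal p * layerDeficit p v
      ≤ ∫⁻ x, ENNReal.ofReal (ballVolume x ^ p) * ENNReal.ofReal (v x - schwarz v x) := by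
  have hsm := measurable_schwarz hd hM
  have hw : Measurable fun x : EuclideanSpace ℝ (Fin d) => ENNReal.ofReal (ballVolume x ^ p) :=
    (measurable_ballVolume.pow_const p).ennreal_ofReal
  have hQ : Measurable fun t : ℝ =>
      volume {x | t < v x} ^ (p - 1) * volume ({x | t < v x} \ {x | t < schwarz v x}) ^ 2 :=
    ((measurable_volume_superlevel v).pow_const _).mul
      ((measurable_volume_superlevel_diff hvm hsm).pow_const 2)
  rw [lintegral_mul_ofReal_sub_eq_lintegral_layer hsm hvm hv0 hw,
    lintegral_mul_ofReal_sub_eq_lintegral_layer hvm hsm (schwarz_nonneg v) hw, layerDeficit,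
    ← lintegral_const_mul _ hQ, ← lintegral_add_right _ (hQ.const_mul _)]
  refine setLIntegral_mono' measurableSet_Ioi fun t (ht : 0 < t) => ?_
  exact setLIntegral_rpow_sublevel_diff_add_le measurable_ballVolume ballVolume_nonneg
    (volume_ballVolume_lt hd) hp0 hp1 (measurableSet_lt measurable_const hvm)
    (volume_superlevel_ne_top hv ht) (superlevel_schwarz hd hM ht.le)

/-- The positive and negative parts have layers {v > t} \ {v* > t} and {v* > t} \ {v > t}, of equal
measure; hence the factor 2. -/
theorem lintegral_enorm_sub_schwarz (hd : 1 ≤ d) {v : EuclideanSpace ℝ (Fin d) → ℝ}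
    (hvm : Measurable v) (hv0 : ∀ x, 0 ≤ v x) (hv : Integrable v) {M : ℝ≥0}
    (hM : distribution v M = 0) :
    ∫⁻ x, ‖v x - schwarz v x‖ₑ
      = ∫⁻ t in Set.Ioi (0 : ℝ), 2 * volume ({x | t < v x} \ {x | t < schwarz v x}) := by
  have hsm := measurable_schwarz hd hM
  have h1 := lintegral_mul_ofReal_sub_eq_lintegral_layer (μ := volume) hvm hsm (schwarz_nonneg v)
    (w := fun _ => 1) measurable_const
  have h2 := lintegral_mul_ofReal_sub_eq_lintegral_layer (μ := volume) hsm hvm hv0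
    (w := fun _ => 1) measurable_const
  simp only [one_mul, setLIntegral_const] at h1 h2
  have habs : ∀ x, ‖v x - schwarz v x‖ₑ
      = ENNReal.ofReal (v x - schwarz v x) + ENNReal.ofReal (schwarz v x - v x) := by
    intro x
    rw [Real.enorm_eq_ofReal_abs]
    rcases le_total (v x) (schwarz v x) with h | h
    · rw [abs_of_nonpos (sub_nonpos.2 h), neg_sub, ENNReal.ofReal_of_nonpos (sub_nonpos.2 h),
        zero_add]
    · rw [abs_of_nonneg (sub_nonneg.2 h), ENNReal.ofReal_of_nonpos (sub_nonpos.2 h), add_zero]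
  have hm : Measurable fun x => ENNReal.ofReal (v x - schwarz v x) :=
    (hvm.sub hsm).ennreal_ofReal
  simp_rw [habs]
  rw [lintegral_add_left hm, h1, h2,
    ← lintegral_add_left (measurable_volume_superlevel_diff hvm hsm)]
  refine setLIntegral_congr_fun measurableSet_Ioi fun t (ht : 0 < t) => ?_
  have hfin := volume_superlevel_ne_top hv ht
  have h := measure_sdiff_comm_of_measure_eq (μ := volume)
    (measurableSet_lt (measurable_const (a := t)) hsm)
    (measurableSet_lt (measurable_const (a := t)) hvm)
    (volume_superlevel_schwarz hd hM ht.le hfin) hfin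
  simp only [h, two_mul]

/-- Cauchy–Schwarz splits 2δ as (4a^{p-1}δ²)^{1/2} (a^{1-p})^{1/2}; Hölder then controls the
integral of a^{1-p}. -/
theorem lintegral_enorm_sub_schwarz_sq_le (hd : 1 ≤ d) {p : ℝ} (hp0 : 0 ≤ p)
    (hp1 : p ≤ 1) {v : EuclideanSpace ℝ (Fin d) → ℝ} (hvm : Measurable v) (hv0 : ∀ x, 0 ≤ v x)
    (hv : Integrable v) {M : ℝ≥0} (hM : distribution v M = 0) :
    (∫⁻ x, ‖v x - schwarz v x‖ₑ) ^ 2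
      ≤ 4 * layerDeficit p v * ((∫⁻ x, ‖v x‖ₑ) ^ (1 - p) * (M : ℝ≥0∞) ^ p) := by
  have hsm := measurable_schwarz hd hM
  set a : ℝ → ℝ≥0∞ := fun t => volume {x | t < v x} with ha
  set δ : ℝ → ℝ≥0∞ := fun t => volume ({x | t < v x} \ {x | t < schwarz v x}) with hδ
  -- The cutoff at `M` loses nothing, since higher layers are null, and its integral supplies the
  -- sup norm in Hölder's inequality.
  set χ : ℝ → ℝ≥0∞ := (Set.Iio (M : ℝ)).indicator 1 with hχ
  have ham : Measurable a := measurable_volume_superlevel v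
  have hδm : Measurable δ := measurable_volume_superlevel_diff hvm hsm
  have hχm : Measurable χ := measurable_one.indicator measurableSet_Iio
  have hN : ∫⁻ t in Set.Ioi (0 : ℝ), a t = ∫⁻ x, ‖v x‖ₑ := by
    have h := lintegral_mul_ofReal_sub_eq_lintegral_layer (μ := volume) hvm
      (g := fun _ => 0) measurable_const (fun _ => le_rfl) (w := fun _ => 1) measurable_const
    simp only [one_mul, setLIntegral_const, sub_zero] at h
    calc ∫⁻ t in Set.Ioi (0 : ℝ), a t
        = ∫⁻ t in Set.Ioi (0 : ℝ), volume ({x | t < v x} \ {_x | t < 0}) := by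
          refine setLIntegral_congr_fun measurableSet_Ioi fun t (ht : 0 < t) => ?_
          simp [ha, not_lt.2 ht.le]
      _ = ∫⁻ x, ‖v x‖ₑ := by
          rw [← h]
          exact lintegral_congr fun x => (Real.enorm_of_nonneg (hv0 x)).symm
  have hχint : ∫⁻ t in Set.Ioi (0 : ℝ), χ t = M := by
    rw [hχ, lintegral_indicator_one measurableSet_Iio, Measure.restrict_apply measurableSet_Iio,
      Set.inter_comm, Set.Ioi_inter_Iio, Real.volume_Ioo, sub_zero, ENNReal.ofReal_coe_nnreal]
  have hG : ∫⁻ t in Set.Ioi (0 : ℝ), a t ^ (1 - p) * χ t ^ p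
      ≤ (∫⁻ x, ‖v x‖ₑ) ^ (1 - p) * (M : ℝ≥0∞) ^ p := by
    rw [← hN, ← hχint]
    exact ENNReal.lintegral_mul_norm_pow_le ham.aemeasurable hχm.aemeasurable
      (sub_nonneg.2 hp1) hp0 (by ring)
  have hQm : Measurable fun t => a t ^ (p - 1) * δ t ^ 2 :=
    (ham.pow_const _).mul (hδm.pow_const 2)
  have hGm : Measurable fun t => a t ^ (1 - p) * χ t ^ p :=
    (ham.pow_const _).mul (hχm.pow_const _)
  have hF : ∫⁻ t in Set.Ioi (0 : ℝ), 4 * (a t ^ (p - 1) * δ t ^ 2) = 4 * layerDeficit p v := by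
    rw [lintegral_const_mul _ hQm, layerDeficit]
  have hpt : ∀ t ∈ Set.Ioi (0 : ℝ), 2 * δ t
      ≤ (4 * (a t ^ (p - 1) * δ t ^ 2)) ^ (1 / 2 : ℝ) * (a t ^ (1 - p) * χ t ^ p) ^ (1 / 2 : ℝ) := by
    intro t (ht : 0 < t)
    have hδa : δ t ≤ a t := measure_mono Set.sdiff_subset
    rcases eq_or_ne (a t) 0 with h0 | h0
    · have : δ t = 0 := le_antisymm (hδa.trans h0.le) zero_le
      simp [this]
    have htM : t < M := by
      by_contra! h
      exact h0 (le_antisymm ((measure_mono fun x (hx : t < v x) => lt_of_le_of_lt h hx).trans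
        hM.le) zero_le)
    have hχt : χ t = 1 := Set.indicator_of_mem htM 1
    have hfin : a t ≠ ∞ := volume_superlevel_ne_top hv ht
    rw [← ENNReal.mul_rpow_of_nonneg _ _ (by norm_num), hχt, ENNReal.one_rpow, mul_one]
    have : 4 * (a t ^ (p - 1) * δ t ^ 2) * a t ^ (1 - p) = (2 * δ t) ^ (2 : ℝ) := by
      calc 4 * (a t ^ (p - 1) * δ t ^ 2) * a t ^ (1 - p)
          = 4 * δ t ^ 2 * (a t ^ (p - 1) * a t ^ (1 - p)) := by ring
        _ = (2 * δ t) ^ 2 := by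
          rw [← ENNReal.rpow_add _ _ h0 hfin]
          simp only [sub_add_sub_cancel, sub_self, ENNReal.rpow_zero]
          ring
        _ = (2 * δ t) ^ (2 : ℝ) := (ENNReal.rpow_ofNat _ 2).symm
    rw [this, ← ENNReal.rpow_mul]
    norm_num
  have hCS : ∫⁻ x, ‖v x - schwarz v x‖ₑ
      ≤ (4 * layerDeficit p v) ^ (1 / 2 : ℝ)
        * ((∫⁻ x, ‖v x‖ₑ) ^ (1 - p) * (M : ℝ≥0∞) ^ p) ^ (1 / 2 : ℝ) := by
    rw [lintegral_enorm_sub_schwarz hd hvm hv0 hv hM]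
    refine (setLIntegral_mono' measurableSet_Ioi hpt).trans ?_
    refine (ENNReal.lintegral_mul_norm_pow_le (hQm.const_mul 4).aemeasurable
      hGm.aemeasurable (by norm_num) (by norm_num)
      (by norm_num)).trans ?_
    rw [hF]
    gcongr
  rw [← ENNReal.mul_rpow_of_nonneg _ _ (by norm_num)] at hCS
  refine (pow_le_pow_left₀ zero_le hCS 2).trans (le_of_eq ?_)
  rw [← ENNReal.rpow_ofNat, ← ENNReal.rpow_mul]
  norm_num

/-! ### Assembling the constants and passing to general representatives -/

/-- The inequality for measurable representatives. -/
theorem lintegral_stability_of_measurable (hd : 1 ≤ d) {m : ℝ} (hm0 : 0 ≤ m) (hmd : m ≤ (d : ℝ))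
    {v : EuclideanSpace ℝ (Fin d) → ℝ} (hvm : Measurable v) (hv0 : ∀ x, 0 ≤ v x)
    (hv : MemLp v 1) (hvinf : MemLp v ∞) :
    (∫⁻ x, ENNReal.ofReal (‖x‖ ^ m * (schwarz v x - v x)))
        + ENNReal.ofReal (stabilityConst m v)
          * eLpNorm (fun x => v x - schwarz v x) 1 volume ^ 2
      ≤ ∫⁻ x, ENNReal.ofReal (‖x‖ ^ m * (v x - schwarz v x)) := by
  have hint : Integrable v := memLp_one_iff_integrable.1 hv
  have hd0 : (0 : ℝ) < d := by exact_mod_cast hd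
  obtain ⟨p, hp⟩ : ∃ p : ℝ, p = m / d := ⟨_, rfl⟩
  have hp0 : 0 ≤ p := hp ▸ div_nonneg hm0 hd0.le
  have hp1 : p ≤ 1 := hp ▸ (div_le_one hd0).2 hmd
  obtain ⟨M, hMeq⟩ : ∃ M : ℝ≥0, eLpNorm v ∞ volume = M :=
    ⟨_, (ENNReal.coe_toNNReal hvinf.2.ne).symm⟩
  have hvM : ∀ᵐ x, v x ≤ M := by
    filter_upwards [ae_le_eLpNormEssSup (f := v) (μ := volume)] with x hx
    rw [← eLpNorm_exponent_top, hMeq, Real.enorm_of_nonneg (hv0 x)] at hx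
    exact (ENNReal.ofReal_le_iff_le_toReal ENNReal.coe_ne_top).1 hx
  have hM : distribution v M = 0 := by
    rw [ae_iff] at hvM
    simpa only [distribution, not_le] using hvM
  have hK := unitBallVolume_pos d
  have hweight : ∀ x : EuclideanSpace ℝ (Fin d),
      ‖x‖ ^ m = unitBallVolume d ^ (-p) * ballVolume x ^ p := by
    intro x
    rw [ballVolume, Real.mul_rpow hK.le (by positivity), ← mul_assoc, ← Real.rpow_add hK,
      neg_add_cancel, Real.rpow_zero, one_mul, ← Real.rpow_natCast, ← Real.rpow_mul (norm_nonneg x),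
      hp, mul_div_cancel₀ _ hd0.ne']
  have hsplit : ∀ (x : EuclideanSpace ℝ (Fin d)) (y : ℝ), ENNReal.ofReal (‖x‖ ^ m * y)
      = ENNReal.ofReal (unitBallVolume d ^ (-p))
        * (ENNReal.ofReal (ballVolume x ^ p) * ENNReal.ofReal y) := by
    intro x y
    rw [hweight, mul_assoc, ENNReal.ofReal_mul (by positivity), ENNReal.ofReal_mul
      (Real.rpow_nonneg (ballVolume_nonneg x) p)]
  simp_rw [hsplit]
  rw [lintegral_const_mul' _ _ ENNReal.ofReal_ne_top, lintegral_const_mul' _ _ ENNReal.ofReal_ne_top]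
  refine le_trans ?_ (mul_le_mul_right
    (lintegral_rpow_ballVolume_add_layerDeficit_le hd hp0 hp1 hvm hv0 hint hM) _)
  rw [mul_add]
  refine add_le_add le_rfl ?_
  have hsq := lintegral_enorm_sub_schwarz_sq_le hd hp0 hp1 hvm hv0 hint hM
  rw [eLpNorm_one_eq_lintegral_enorm]
  rw [← eLpNorm_one_eq_lintegral_enorm (f := v)] at hsq
  refine (mul_le_mul_right hsq _).trans ?_
  -- When `v` vanishes a.e. the bound must be zero; for p = 1 the factor ‖v‖₁^{1-p} equals 1, and
  -- the sup norm has to provide the zero.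
  rcases eq_or_ne (eLpNorm v 1 volume) 0 with hN0 | hN0
  · have hM0 : M = 0 := by
      rw [eLpNorm_eq_zero_iff hvm.aestronglyMeasurable one_ne_zero] at hN0
      have := (eLpNorm_eq_zero_iff hvm.aestronglyMeasurable ENNReal.top_ne_zero).2 hN0
      exact_mod_cast hMeq.symm.trans this
    have hzero : eLpNorm v 1 volume ^ (1 - p) * (M : ℝ≥0∞) ^ p = 0 := by
      rcases hp1.lt_or_eq with h | h
      · rw [hN0, ENNReal.zero_rpow_of_pos (sub_pos.2 h), zero_mul]
      · simp [hM0, h]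
    simp [hzero]
  · have hMpos : (0 : ℝ) < M := by
      refine NNReal.coe_pos.2 (pos_iff_ne_zero.2 fun h => hN0 ?_)
      rw [h, ENNReal.coe_zero, eLpNorm_eq_zero_iff hvm.aestronglyMeasurable ENNReal.top_ne_zero]
        at hMeq
      exact (eLpNorm_eq_zero_iff hvm.aestronglyMeasurable one_ne_zero).2 hMeq
    obtain ⟨n, hn0, hn⟩ : ∃ n : ℝ, 0 < n ∧ eLpNorm v 1 volume = ENNReal.ofReal n :=
      ⟨_, ENNReal.toReal_pos hN0 hv.2.ne, (ENNReal.ofReal_toReal hv.2.ne).symm⟩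
    have hconst : stabilityConst m v * (4 * (n ^ (1 - p) * (M : ℝ) ^ p))
        = unitBallVolume d ^ (-p) * p := by
      have e1 : n ^ (-1 + p) * n ^ (1 - p) = 1 := by
        rw [← Real.rpow_add hn0]
        simp
      have e2 : (M : ℝ) ^ (-p) * (M : ℝ) ^ p = 1 := by
        rw [← Real.rpow_add hMpos]
        simp
      have e3 : m / (4 * (d : ℝ)) = p / 4 := by
        rw [hp]
        field_simp
      rw [stabilityConst, hn, hMeq, ENNReal.toReal_ofReal hn0.le, ENNReal.coe_toReal, ← hp, e3]
      calc _ = unitBallVolume d ^ (-p) * p * (n ^ (-1 + p) * n ^ (1 - p))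
            * ((M : ℝ) ^ (-p) * (M : ℝ) ^ p) := by ring
        _ = _ := by rw [e1, e2, mul_one, mul_one]
    have hcast : (4 : ℝ≥0∞) * (eLpNorm v 1 volume ^ (1 - p) * (M : ℝ≥0∞) ^ p)
        = ENNReal.ofReal (4 * (n ^ (1 - p) * (M : ℝ) ^ p)) := by
      rw [hn, ENNReal.ofReal_rpow_of_pos hn0, ← ENNReal.ofReal_coe_nnreal (p := M),
        ENNReal.ofReal_rpow_of_pos hMpos, ENNReal.ofReal_mul (by norm_num),
        ENNReal.ofReal_mul (by positivity), ENNReal.ofReal_ofNat]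
    refine le_of_eq ?_
    calc _ = ENNReal.ofReal (stabilityConst m v)
          * (4 * (eLpNorm v 1 volume ^ (1 - p) * (M : ℝ≥0∞) ^ p)) * layerDeficit p v := by ring
      _ = ENNReal.ofReal (unitBallVolume d ^ (-p) * p) * layerDeficit p v := by
        rw [hcast, ← ENNReal.ofReal_mul' (by positivity), hconst]
      _ = _ := by rw [ENNReal.ofReal_mul (by positivity), mul_assoc]

end

end Rearrangement

/-- The integral of `|x|^m (u - u*)` has positive part `∫ |x|^m (u - u*)₊` and negative part
`∫ |x|^m (u - u*)₋` in `[0, ∞]`. The first assertion is the inequality for that integral in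
`(-∞, ∞]` as soon as one of the two parts is finite, with the negative part moved to the other side;
the second one is the inequality of real numbers when the integrand is integrable. -/
theorem corollary1 (d : ℕ) (hd : 1 ≤ d) (m : ℝ) (hm0 : 0 ≤ m) (hmd : m ≤ (d : ℝ))
    (u : EuclideanSpace ℝ (Fin d) → ℝ) (hu0 : 0 ≤ᵐ[volume] u)
    (hu1 : MemLp u 1 volume) (huinf : MemLp u ∞ volume) :
    ((∫⁻ x, ENNReal.ofReal (‖x‖ ^ m * (Rearrangement.schwarz u x - u x)))
        + ENNReal.ofReal (Rearrangement.stabilityConst m u)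
          * eLpNorm (fun x => u x - Rearrangement.schwarz u x) 1 volume ^ 2
      ≤ ∫⁻ x, ENNReal.ofReal (‖x‖ ^ m * (u x - Rearrangement.schwarz u x)))
    ∧ (Integrable (fun x => ‖x‖ ^ m * (u x - Rearrangement.schwarz u x)) volume →
        Rearrangement.stabilityConst m u
            * (∫ x, |u x - Rearrangement.schwarz u x|) ^ 2
          ≤ ∫ x, ‖x‖ ^ m * (u x - Rearrangement.schwarz u x)) := by

  obtain ⟨v, hvm, hv0, huv⟩ : ∃ v : EuclideanSpace ℝ (Fin d) → ℝ,
      Measurable v ∧ (∀ x, 0 ≤ v x) ∧ u =ᵐ[volume] v := by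
    refine ⟨fun x => max 0 (hu1.1.mk u x),
      measurable_const.max hu1.1.stronglyMeasurable_mk.measurable, fun x => le_max_left _ _, ?_⟩
    filter_upwards [hu1.1.ae_eq_mk, hu0] with x hx hx0
    rw [← hx]
    exact (max_eq_right hx0).symm
  have hpos : (∫⁻ x, ENNReal.ofReal (‖x‖ ^ m * (Rearrangement.schwarz u x - u x)))
        + ENNReal.ofReal (Rearrangement.stabilityConst m u)
          * eLpNorm (fun x => u x - Rearrangement.schwarz u x) 1 volume ^ 2
      ≤ ∫⁻ x, ENNReal.ofReal (‖x‖ ^ m * (u x - Rearrangement.schwarz u x)) := by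
    have h := Rearrangement.lintegral_stability_of_measurable hd hm0 hmd hvm hv0
      ((memLp_congr_ae huv).1 hu1) ((memLp_congr_ae huv).1 huinf)
    have h1 : ∫⁻ x, ENNReal.ofReal (‖x‖ ^ m * (Rearrangement.schwarz v x - u x))
        = ∫⁻ x, ENNReal.ofReal (‖x‖ ^ m * (Rearrangement.schwarz v x - v x)) :=
      lintegral_congr_ae (huv.mono fun x hx => by simp only [hx])
    have h2 : ∫⁻ x, ENNReal.ofReal (‖x‖ ^ m * (u x - Rearrangement.schwarz v x))
        = ∫⁻ x, ENNReal.ofReal (‖x‖ ^ m * (v x - Rearrangement.schwarz v x)) :=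
      lintegral_congr_ae (huv.mono fun x hx => by simp only [hx])
    have h3 : eLpNorm (fun x => u x - Rearrangement.schwarz v x) 1 volume
        = eLpNorm (fun x => v x - Rearrangement.schwarz v x) 1 volume :=
      eLpNorm_congr_ae (huv.mono fun x hx => by simp only [hx])
    have h4 : Rearrangement.stabilityConst m u = Rearrangement.stabilityConst m v := by
      simp only [Rearrangement.stabilityConst, eLpNorm_congr_ae huv]
    rw [Rearrangement.schwarz_congr_ae huv, h1, h2, h3, h4]
    exact h
  refine ⟨hpos, fun hint => ?_⟩
  have hc0 : 0 ≤ Rearrangement.stabilityConst m u := by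
    have := (Rearrangement.unitBallVolume_pos d).le
    unfold Rearrangement.stabilityConst
    positivity
  have hneg : ∀ x, -(‖x‖ ^ m * (u x - Rearrangement.schwarz u x))
      = ‖x‖ ^ m * (Rearrangement.schwarz u x - u x) := fun x => by ring
  have hP : ∫⁻ x, ENNReal.ofReal (‖x‖ ^ m * (u x - Rearrangement.schwarz u x)) ≠ ∞ :=
    (hint.lintegral_lt_top).ne
  -- The inequality just proved bounds the negative part by the finite positive part.
  have hN : ∫⁻ x, ENNReal.ofReal (‖x‖ ^ m * (Rearrangement.schwarz u x - u x)) ≠ ∞ :=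
    ne_top_of_le_ne_top hP (le_self_add.trans hpos)
  -- This direction suffices and needs no integrability of u - u*.
  have habs : ENNReal.ofReal (∫ x, |u x - Rearrangement.schwarz u x|)
      ≤ eLpNorm (fun x => u x - Rearrangement.schwarz u x) 1 volume := by
    rw [eLpNorm_one_eq_lintegral_enorm]
    refine (Real.ofReal_le_enorm _).trans ((enorm_integral_le_lintegral_enorm _).trans_eq ?_)
    exact lintegral_congr fun x => by rw [Real.enorm_abs]
  rw [integral_eq_lintegral_pos_part_sub_lintegral_neg_part hint]
  simp_rw [hneg]
  rw [le_sub_iff_add_le', ← ENNReal.ofReal_le_iff_le_toReal hP,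
    ENNReal.ofReal_add ENNReal.toReal_nonneg (by positivity), ENNReal.ofReal_toReal hN,
    ENNReal.ofReal_mul hc0, ENNReal.ofReal_pow (integral_nonneg fun x => abs_nonneg _)]
  refine le_trans ?_ hpos
  gcongr
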